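/- Let $p$ be a prime, $\bar{\mathbb F}_p$ an algebraic closure of $\mathbb F_p$, and $F$ a non-archimedean local field of residue characteristic $p$. Let $G_S=\mathrm{SL}_2(F)$ and let $B_S\subset G_S$ be the Borel subgroup of upper triangular matrices. A representation of a topological group over $\bar{\mathbb F}_p$ is called smooth if every vector is fixed by some compact open subgroup. For a smooth character $\eta:B_S\to\bar{\mathbb F}_p^{\times}$, let $\mathrm{Ind}_{B_S}^{G_S}(\eta)$ be the space of all functions $f:G_S\to\bar{\mathbb F}_p$ such that $f(bg)=\eta(b)f(g)$ for all $b\in B_S$, $g\in G_S$, and such that $f$ has open stabilizer under the action $(g\cdot f)(g')=f(g'g)$ of $G_S$. Let $\eta\neq 1$ be a smooth $\bar{\mathbb F}_p$-character of $B_S$ and let $\pi$ be a smooth $\bar{\mathbb F}_p$-representation of $G_S$. Then the restriction map $$\mathrm{Hom}_{G_S}(\mathrm{Ind}_{B_S}^{G_S}(\eta),\pi)\longrightarrow \mathrm{Hom}_{B_S}(\mathrm{Ind}_{B_S}^{G_S}(\eta),\pi),$$ which regards a $G_S$-equivariant linear map as a $B_S$-equivariant one, is an isomorphism of $\bar{\mathbb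 F}_p$-vector spaces. In other words, every $B_S$-equivariant linear map $\mathrm{Ind}_{B_S}^{G_S}(\eta)\to\pi$ is automatically $G_S$-equivariant. -/

import Mathlib

open scoped ValuativeRel

namespace SmoothRep

section General

variable {k G V : Type*} [CommRing k] [Group G] [AddCommGroup V] [Module k V]

/-- A representation of a topological group `G` is smooth if every vector is fixed by some
compact open subgroup of `G`. -/
def IsSmooth [TopologicalSpace G] (ρ : Representation k G V) : Prop :=
  ∀ v : V, ∃ K : Subgroup G, IsOpen (K : Set G) ∧ IsCompact (K : Set G) ∧ ∀ g ∈ K, ρ g v = v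

/-- The stabilizer of a vector `v` in a representation. -/
def stab (ρ : Representation k G V) (v : V) : Subgroup G where
  carrier := {g | ρ g v = v}
  one_mem' := by simp
  mul_mem' := by
    intro a b ha hb
    simp only [Set.mem_ofPred_eq] at ha hb ⊢
    rw [map_mul, Module.End.mul_apply, hb, ha]
  inv_mem' := by
    intro a ha
    simp only [Set.mem_ofPred_eq] at ha ⊢
    conv_lhs => rw [← ha]
    rw [← Module.End.mul_apply, ← map_mul, inv_mul_cancel, map_one, Module.End.one_apply]

theorem mem_stab {ρ : Representation k G V} {v : V} {g : G} : g ∈ stab ρ v ↔ ρ g v = v := Iff.rfl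

/-- The smooth part of a representation: the subrepresentation of all vectors whose stabilizer
is open. -/
def smoothPart [TopologicalSpace G] [IsTopologicalGroup G] (ρ : Representation k G V) :
    Subrepresentation ρ where
  toSubmodule :=
    { carrier := {v | IsOpen (stab ρ v : Set G)}
      zero_mem' := by
        have h : stab ρ (0 : V) = ⊤ := by ext g; simp [mem_stab]
        simp [h]
      add_mem' := by
        intro v w hv hw
        simp only [Set.mem_ofPred_eq] at hv hw ⊢
        have hle : stab ρ v ⊓ stab ρ w ≤ stab ρ (v + w) := by
          intro g hg
          have h1 : ρ g v = v := hg.1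
          have h2 : ρ g w = w := hg.2
          rw [mem_stab, map_add, h1, h2]
        exact Subgroup.isOpen_mono hle (by simpa using hv.inter hw)
      smul_mem' := by
        intro c v hv
        simp only [Set.mem_ofPred_eq] at hv ⊢
        have hle : stab ρ v ≤ stab ρ (c • v) := by
          intro g hg
          have h1 : ρ g v = v := hg
          rw [mem_stab, map_smul, h1]
        exact Subgroup.isOpen_mono hle hv }
  apply_mem_toSubmodule := by
    intro g v hv
    change IsOpen (stab ρ (ρ g v) : Set G)
    have hv' : IsOpen (stab ρ v : Set G) := hv
    have h : (stab ρ (ρ g v) : Set G) = (fun x => g⁻¹ * x * g) ⁻¹' (stab ρ v : Set G) := by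
      ext x
      simp only [SetLike.mem_coe, mem_stab, Set.mem_preimage, map_mul, Module.End.mul_apply]
      constructor
      · intro hx
        rw [hx, ← Module.End.mul_apply, ← map_mul, inv_mul_cancel, map_one, Module.End.one_apply]
      · intro hx
        have h2 := congrArg (ρ g) hx
        rwa [← Module.End.mul_apply, ← map_mul, mul_inv_cancel, map_one,
          Module.End.one_apply] at h2
    rw [h]
    exact hv'.preimage (by fun_prop)

/-- The smooth induction `Ind_H^G σ` of a representation `σ` of a subgroup `H`: the smooth part of
the space of all functions `f : G → σ` with `f (h g) = σ h (f g)` for all `h ∈ H`, `g ∈ G`,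
on which `G` acts by right translation, `(g • f) g' = f (g' g)`. -/
abbrev smoothInd [TopologicalSpace G] [IsTopologicalGroup G] (H : Subgroup G)
    (σ : Representation k H V) :
    Representation k G (smoothPart (Representation.coind H.subtype σ)).toSubmodule :=
  (smoothPart (Representation.coind H.subtype σ)).toRepresentation

end General

/-- The one-dimensional representation on `k` given by a character `η : H → kˣ`. -/
def ofChar {k H : Type*} [CommRing k] [Group H] (η : H →* kˣ) : Representation k H k where
  toFun h := (η h : k) • LinearMap.id
  map_one' := by ext; simp
  map_mul' a b := by ext; simp [mul_comm]

section Restriction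

variable {k G V W : Type*} [CommRing k] [Group G] [AddCommMonoid V] [Module k V]
  [AddCommMonoid W] [Module k W]

/-- The restriction of a representation to a subgroup. -/
abbrev res (H : Subgroup G) (ρ : Representation k G V) : Representation k H V :=
  ρ.comp H.subtype

/-- The restriction map `Hom_G(ρ, π) → Hom_H(ρ|_H, π|_H)`, sending a `G`-intertwiner to the same
linear map regarded as an `H`-intertwiner. -/
def resHom (H : Subgroup G) (ρ : Representation k G V) (π : Representation k G W) :
    Representation.IntertwiningMap ρ π →ₗ[k]
      Representation.IntertwiningMap (res H ρ) (res H π) where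
  toFun φ := ⟨φ.toLinearMap, fun h => φ.isIntertwining' (h : G)⟩
  map_add' _ _ := rfl
  map_smul' _ _ := rfl

end Restriction

/-- The Borel subgroup of upper triangular matrices in `SL₂(F)`. -/
def borel (F : Type*) [Field F] : Subgroup (Matrix.SpecialLinearGroup (Fin 2) F) where
  carrier := {g | g 1 0 = 0}
  one_mem' := by simp
  mul_mem' := by
    intro a b ha hb
    simp only [Set.mem_ofPred_eq] at ha hb ⊢
    simp [Matrix.mul_apply, Fin.sum_univ_two, ha, hb]
  inv_mem' := by
    intro a ha
    simp only [Set.mem_ofPred_eq] at ha ⊢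
    simp [Matrix.SpecialLinearGroup.coe_inv, Matrix.adjugate_fin_two, ha]

end SmoothRep

/-!
A map `φ` from `Ind η` to `π` that commutes with the Borel subgroup `B` commutes with `g` at the
vector `f` as soon as `g` lies in `B * K` for an open subgroup `K` fixing both `f` and `φ f`. So the
task is to enlarge this set of `g` to all of `SL₂(F)`, and since `SL₂(F)` is generated by `B` and
the Weyl element `w`, it suffices to show that the defect `f ↦ φ (w f) - w (φ f)` vanishes
(`weylDefect_eq_zero`).

An element `f` of `Ind η` is described by its value at `1` and by the locally constant function
`x ↦ f (w u(x))` on `F`, where `u(x)` is upper unipotent. The element `bigCell` vanishes at `1` and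
corresponds to the indicator function of the ring of integers `𝒪`; its translates by `B` are
multiples of the indicator functions of the balls `x + s² 𝒪`.

* If `f` vanishes at `1` and near `x = 0`, then it is a finite sum of such translates by
  `u(-x) diag(s, s⁻¹)` with `s` arbitrarily small and `x` bounded away from `0`
  (`eventually_decomposition`). Now `w u(-x) diag(s, s⁻¹)` is an element of `B` times the lower
  unipotent matrix with entry `-s² / x`, which fixes `bigCell` and its image under `φ` when `s` is
  small. Hence the defect of `f` is zero (`weylDefect_eq_zero_of_vanishing`).
* The function `bigCell` and `η(t)` times its translate by `t = diag(s, s⁻¹)` agree near `x = 0`.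
  So the defect `d` of `bigCell` satisfies `t d = η(t) d` for all `t` in the torus. In a smooth
  representation the unipotent matrices close to `1` fix `d`, and conjugation by the torus carries
  this over to all unipotent matrices. These generate `SL₂(F)`, so `SL₂(F)` fixes `d`; as `η` is
  nontrivial on the torus, `d = 0` (`eq_zero_of_torus_eigenvector`, `weylDefect_bigCell_eq_zero`).
* Every `f` vanishing at `1` is a multiple of `bigCell` plus a function vanishing near `x = 0`, and
  every `f` is a multiple of `w bigCell` plus a function vanishing at `1`. Since `w²` lies in `B`,
  the defect of `w bigCell` vanishes along with that of `bigCell`.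

Since the torus contracts the unipotent matrices by conjugation, `η` is trivial on them
(`apply_upper`), so that it is determined by its restriction `torusChar` to the torus.
-/

namespace SmoothRep

open Topology Matrix

/-! ### Neighbourhoods of zero in a local field -/

theorem mem_integers_or_inv_mem {F : Type*} [Field F] [ValuativeRel F] (x : F) :
    x ∈ 𝒪[F] ∨ x⁻¹ ∈ 𝒪[F] := by
  rw [Valuation.mem_integer_iff, Valuation.mem_integer_iff]
  rcases le_or_gt (ValuativeRel.valuation F x) 1 with h | h
  · exact Or.inl h
  · right
    rw [map_inv₀]
    exact inv_le_one_of_one_le₀ h.le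

section LocalField

variable {F : Type*} [Field F] [ValuativeRel F] [TopologicalSpace F]
  [IsNonarchimedeanLocalField F]

theorem isOpen_integers : IsOpen (𝒪[F] : Set F) := Valuation.isOpen_integer

theorem isCompact_integers : IsCompact (𝒪[F] : Set F) :=
  IsNonarchimedeanLocalField.isCompact_closedBall F 1

theorem t1Space : T1Space F := by
  let := IsTopologicalAddGroup.rightUniformSpace F
  let := isUniformAddGroup_of_addCommGroup (G := F)
  infer_instance

theorem exists_unit_mem {N : Set F} (hN : N ∈ 𝓝 (0 : F)) : ∃ s : Fˣ, (s : F) ∈ N := by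
  obtain ⟨γ, hγ, h⟩ := (IsValuativeTopology.hasBasis_nhds_zero' F).mem_iff.mp hN
  obtain ⟨t, rfl⟩ := ValuativeRel.valuation_surjective γ
  obtain ⟨r, hr0, hr⟩ := Valuation.IsNontrivial.exists_lt_one (v := ValuativeRel.valuation F)
  have ht : t ≠ 0 := by simpa using hγ
  have hr' : r ≠ 0 := by simpa using hr0
  refine ⟨Units.mk0 (r * t) (mul_ne_zero hr' ht), h ?_⟩
  have : 0 < ValuativeRel.valuation F t := zero_lt_iff.mpr hγ
  simpa using mul_lt_of_lt_one_left this hr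

theorem exists_nhds_mul_integers_subset {N : Set F} (hN : N ∈ 𝓝 (0 : F)) :
    ∀ᶠ r in 𝓝 (0 : F), ∀ o ∈ (𝒪[F] : Set F), r * o ∈ N := by
  refine isCompact_integers.eventually_forall_of_forall_eventually fun o _ => ?_
  have h : Filter.Tendsto (fun z : F × F => z.1 * z.2) (𝓝 (0, o)) (𝓝 0) := by
    have : Continuous fun z : F × F => z.1 * z.2 := continuous_mul
    simpa using this.tendsto (0, o)
  exact h hN

theorem exists_unit_mul_integers_subset {N : Set F} (hN : N ∈ 𝓝 (0 : F)) :
    ∃ t : Fˣ, ∀ o ∈ 𝒪[F], (t : F) * o ∈ N :=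
  exists_unit_mem (exists_nhds_mul_integers_subset hN)

theorem exists_unit_sq_mul_mem {N : Set F} (hN : N ∈ 𝓝 (0 : F)) (y : F) :
    ∃ s : Fˣ, (s : F) ^ 2 * y ∈ N := by
  have h : Filter.Tendsto (fun s : F => s ^ 2 * y) (𝓝 0) (𝓝 0) := by
    have : Continuous fun s : F => s ^ 2 * y := by fun_prop
    simpa using this.tendsto 0
  exact exists_unit_mem (h hN)

end LocalField

/-! ### Elements of `SL₂` -/

section Elements

variable {F : Type*} [Field F]

/-- The upper unipotent matrix with entry `x`. -/
def upper (x : F) : Matrix.SpecialLinearGroup (Fin 2) F := ⟨!![1, x; 0, 1], by simp⟩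

/-- The lower unipotent matrix with entry `y`. -/
def lower (y : F) : Matrix.SpecialLinearGroup (Fin 2) F := ⟨!![1, 0; y, 1], by simp⟩

/-- The diagonal matrix with entries `a` and `a⁻¹`. -/
def torus (a : Fˣ) : Matrix.SpecialLinearGroup (Fin 2) F :=
  ⟨!![(a : F), 0; 0, (a : F)⁻¹], by simp⟩

/-- The Weyl element, with rows `(0, 1)` and `(-1, 0)`. -/
def weyl : Matrix.SpecialLinearGroup (Fin 2) F := ⟨!![0, 1; -1, 0], by simp⟩

@[simp] theorem coe_upper (x : F) : (upper x : Matrix (Fin 2) (Fin 2) F) = !![1, x; 0, 1] := rfl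
@[simp] theorem coe_lower (y : F) : (lower y : Matrix (Fin 2) (Fin 2) F) = !![1, 0; y, 1] := rfl
@[simp] theorem coe_torus (a : Fˣ) :
    (torus a : Matrix (Fin 2) (Fin 2) F) = !![(a : F), 0; 0, (a : F)⁻¹] := rfl
@[simp] theorem coe_weyl :
    ((weyl : Matrix.SpecialLinearGroup (Fin 2) F) : Matrix (Fin 2) (Fin 2) F) =
      !![0, 1; -1, 0] := rfl

theorem mem_borel {g : Matrix.SpecialLinearGroup (Fin 2) F} : g ∈ borel F ↔ g 1 0 = 0 := Iff.rfl

theorem upper_mem_borel (x : F) : upper x ∈ borel F := by simp [mem_borel]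

theorem torus_mem_borel (a : Fˣ) : torus a ∈ borel F := by simp [mem_borel]

theorem upper_zero : upper (0 : F) = 1 := by
  ext i j; fin_cases i <;> fin_cases j <;> simp

theorem lower_zero : lower (0 : F) = 1 := by
  ext i j; fin_cases i <;> fin_cases j <;> simp

theorem upper_add (x y : F) : upper (x + y) = upper x * upper y := by
  ext i j; fin_cases i <;> fin_cases j <;> simp [add_comm]

theorem lower_inv (y : F) : (lower y)⁻¹ = lower (-y) := by
  refine inv_eq_of_mul_eq_one_right ?_
  ext i j; fin_cases i <;> fin_cases j <;> simp

theorem torus_one : torus (1 : Fˣ) = 1 := by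
  ext i j; fin_cases i <;> fin_cases j <;> simp

theorem torus_mul (a b : Fˣ) : torus (a * b) = torus a * torus b := by
  ext i j; fin_cases i <;> fin_cases j <;> simp [mul_comm]

theorem torus_mul_upper (a : Fˣ) (x : F) :
    torus a * upper x = upper ((a : F) ^ 2 * x) * torus a := by
  ext i j; fin_cases i <;> fin_cases j <;> simp
  field_simp

theorem lower_mul_torus (a : Fˣ) (y : F) :
    lower y * torus a = torus a * lower ((a : F) ^ 2 * y) := by
  ext i j; fin_cases i <;> fin_cases j <;> simp
  field_simp

theorem weyl_mul_torus (a : Fˣ) : weyl * torus a = torus a⁻¹ * weyl := by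
  ext i j; fin_cases i <;> fin_cases j <;> simp

theorem weyl_mul_weyl : (weyl : Matrix.SpecialLinearGroup (Fin 2) F) * weyl = torus (-1) := by
  ext i j; fin_cases i <;> fin_cases j <;> simp

/-- The torus is contained in the group generated by the unipotent matrices. -/
theorem torus_eq_prod (a : Fˣ) :
    torus a = upper (a : F) * lower (-(a : F)⁻¹) * upper (a : F) *
      (upper (-1) * lower 1 * upper (-1)) := by
  ext i j; fin_cases i <;> fin_cases j <;> simp

theorem det_eq (g : Matrix.SpecialLinearGroup (Fin 2) F) : g 0 0 * g 1 1 - g 0 1 * g 1 0 = 1 := by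
  rw [← Matrix.det_fin_two]; exact g.det_coe

theorem apply_mul (g h : Matrix.SpecialLinearGroup (Fin 2) F) (i j : Fin 2) :
    (g * h) i j = g i 0 * h 0 j + g i 1 * h 1 j := by
  simp [Matrix.mul_apply, Fin.sum_univ_two]

theorem coe_inv_eq (g : Matrix.SpecialLinearGroup (Fin 2) F) :
    ((g⁻¹ : Matrix.SpecialLinearGroup (Fin 2) F) : Matrix (Fin 2) (Fin 2) F) =
      !![g 1 1, -g 0 1; -g 1 0, g 0 0] := by
  exact (Matrix.SpecialLinearGroup.coe_inv g).trans (Matrix.adjugate_fin_two _)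

/-- The Bruhat decomposition of the complement of the Borel subgroup. -/
theorem exists_eq_mul_weyl_mul_upper {g : Matrix.SpecialLinearGroup (Fin 2) F} (h : g ∉ borel F) :
    ∃ b ∈ borel F, ∃ x : F, g = b * (weyl * upper x) := by
  refine ⟨g * (weyl * upper (g 1 1 / g 1 0))⁻¹, ?_, g 1 1 / g 1 0, by group⟩
  rw [mem_borel] at h
  rw [mem_borel, apply_mul, coe_inv_eq]
  simp
  field_simp
  ring

theorem borel_apply_zero_zero_mul {b : Matrix.SpecialLinearGroup (Fin 2) F} (hb : b ∈ borel F) :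
    b 0 0 * b 1 1 = 1 := by
  have h := det_eq b
  rw [mem_borel.1 hb] at h
  simpa using h

theorem borel_apply_zero_zero_ne_zero {b : Matrix.SpecialLinearGroup (Fin 2) F}
    (hb : b ∈ borel F) :
    b 0 0 ≠ 0 := left_ne_zero_of_mul_eq_one (borel_apply_zero_zero_mul hb)

theorem eq_torus_mul_upper {b : Matrix.SpecialLinearGroup (Fin 2) F} (hb : b ∈ borel F) :
    b = torus (Units.mk0 (b 0 0) (borel_apply_zero_zero_ne_zero hb)) *
      upper (b 0 1 / b 0 0) := by
  have h := borel_apply_zero_zero_mul hb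
  have h0 := borel_apply_zero_zero_ne_zero hb
  have h1 := mem_borel.1 hb
  ext i j; fin_cases i <;> fin_cases j <;> simp [h1]
  · field_simp
  · exact eq_inv_of_mul_eq_one_right h

section Topology

variable [TopologicalSpace F]

theorem continuous_upper : Continuous (upper : F → Matrix.SpecialLinearGroup (Fin 2) F) := by
  refine Continuous.subtype_mk (continuous_matrix fun i j => ?_) _
  fin_cases i <;> fin_cases j <;> simp <;> fun_prop

theorem continuous_lower : Continuous (lower : F → Matrix.SpecialLinearGroup (Fin 2) F) := by
  refine Continuous.subtype_mk (continuous_matrix fun i j => ?_) _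
  fin_cases i <;> fin_cases j <;> simp <;> fun_prop

theorem continuous_torus [ContinuousInv₀ F] :
    Continuous (torus : Fˣ → Matrix.SpecialLinearGroup (Fin 2) F) := by
  refine Continuous.subtype_mk (continuous_matrix fun i j => ?_) _
  have h : Continuous fun a : Fˣ => (a : F)⁻¹ :=
    Units.continuous_val.inv₀ fun a => a.ne_zero
  fin_cases i <;> fin_cases j <;> simp
  exacts [Units.continuous_val, continuous_const, continuous_const, by simpa using h]

end Topology

end Elements

/-! ### Smooth characters of the Borel subgroup -/

section Character

variable {k : Type*} [Field k] {F : Type*} [Field F] (η : borel F →* kˣ)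

theorem ofChar_apply (b : borel F) (c : k) : ofChar η b c = (η b : k) * c := rfl

/-- The restriction of a character of the Borel subgroup to the diagonal torus, as a map on `F`
that sends `a` to `η (diag (a, a⁻¹))` and `0` to `0`. -/
noncomputable def torusChar : F →*₀ k := by
  classical
  exact
  { toFun := fun a => if h : a = 0 then 0 else
      (η ⟨torus (Units.mk0 a h), torus_mem_borel _⟩ : k)
    map_zero' := by simp
    map_one' := by
      have : (⟨torus (Units.mk0 (1 : F) one_ne_zero), torus_mem_borel _⟩ : borel F) = 1 := by
        ext1
        rw [Units.mk0_one]
        exact torus_one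
      simp only [one_ne_zero, dite_false, this, map_one, Units.val_one]
    map_mul' := by
      intro a b
      rcases eq_or_ne a 0 with rfl | ha
      · simp
      rcases eq_or_ne b 0 with rfl | hb
      · simp
      have : (⟨torus (Units.mk0 (a * b) (mul_ne_zero ha hb)), torus_mem_borel _⟩ : borel F) =
          ⟨torus (Units.mk0 a ha), torus_mem_borel _⟩ *
            ⟨torus (Units.mk0 b hb), torus_mem_borel _⟩ := by
        ext1
        rw [Units.mk0_mul]
        exact torus_mul _ _
      simp only [mul_ne_zero ha hb, ha, hb, dite_false, this, map_mul, Units.val_mul] }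

theorem torusChar_unit (a : Fˣ) : torusChar η a = (η ⟨torus a, torus_mem_borel a⟩ : k) := by
  simp [torusChar]

theorem torusChar_unit_ne_zero (a : Fˣ) : torusChar η (a : F) ≠ 0 := by
  rw [torusChar_unit]; exact Units.ne_zero _

theorem exists_nhds_eq_one [TopologicalSpace F] {η : borel F →* kˣ} (hη : IsSmooth (ofChar η)) :
    ∃ N ∈ 𝓝 (1 : Matrix.SpecialLinearGroup (Fin 2) F), ∀ b : borel F,
      (b : Matrix.SpecialLinearGroup (Fin 2) F) ∈ N →
      η b = 1 := by
  obtain ⟨K, hK, -, h⟩ := hη 1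
  have hK1 : (K : Set (borel F)) ∈ 𝓝 (1 : borel F) := hK.mem_nhds K.one_mem
  rw [nhds_subtype, Filter.mem_comap] at hK1
  obtain ⟨N, hN, hNK⟩ := hK1
  refine ⟨N, hN, fun b hb => ?_⟩
  have := h b (hNK hb)
  rw [ofChar_apply, mul_one] at this
  exact Units.ext this

variable [ValuativeRel F] [TopologicalSpace F] [IsNonarchimedeanLocalField F]

/-- A smooth character is trivial on unipotent matrices, since the torus contracts every
unipotent matrix to the identity by conjugation, and this does not change the value of the
character. -/
theorem apply_upper {η : borel F →* kˣ} (hη : IsSmooth (ofChar η)) (x : F) :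
    η ⟨upper x, upper_mem_borel x⟩ = 1 := by
  obtain ⟨N, hN, h⟩ := exists_nhds_eq_one hη
  have hN0 : upper ⁻¹' N ∈ 𝓝 (0 : F) :=
    continuous_upper.continuousAt.preimage_mem_nhds (by rwa [upper_zero])
  obtain ⟨s, hs⟩ := exists_unit_sq_mul_mem hN0 x
  have h1 := h ⟨upper ((s : F) ^ 2 * x), upper_mem_borel _⟩ hs
  have h2 : (⟨torus s, torus_mem_borel s⟩ * ⟨upper x, upper_mem_borel x⟩ : borel F) =
      ⟨upper ((s : F) ^ 2 * x), upper_mem_borel _⟩ * ⟨torus s, torus_mem_borel s⟩ :=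
    Subtype.ext (torus_mul_upper s x)
  have h3 := congrArg η h2
  rw [map_mul, map_mul, h1, mul_comm] at h3
  exact mul_right_cancel h3

theorem apply_eq_torusChar {η : borel F →* kˣ} (hη : IsSmooth (ofChar η)) (b : borel F) :
    (η b : k) = torusChar η ((b : Matrix.SpecialLinearGroup (Fin 2) F) 0 0) := by
  have h : b = ⟨torus (Units.mk0 _ (borel_apply_zero_zero_ne_zero b.2)), torus_mem_borel _⟩ *
      ⟨upper _, upper_mem_borel _⟩ := Subtype.ext (eq_torus_mul_upper b.2)
  conv_lhs => rw [h]
  rw [map_mul, apply_upper hη, mul_one, ← torusChar_unit, Units.val_mk0]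

theorem exists_torusChar_ne_one {η : borel F →* kˣ} (hη : IsSmooth (ofChar η)) (hη1 : η ≠ 1) :
    ∃ a : Fˣ, torusChar η (a : F) ≠ 1 := by
  by_contra! h
  refine hη1 (MonoidHom.ext fun b => Units.ext ?_)
  rw [apply_eq_torusChar hη]
  exact h (Units.mk0 _ (borel_apply_zero_zero_ne_zero b.2))

theorem torusChar_eventually_eq_one {η : borel F →* kˣ} (hη : IsSmooth (ofChar η)) :
    ∀ᶠ a in 𝓝 (1 : F), torusChar η a = 1 := by
  have := t1Space (F := F)
  obtain ⟨N, hN, h⟩ := exists_nhds_eq_one hη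
  have hN1 : torus ⁻¹' N ∈ 𝓝 (1 : Fˣ) :=
    continuous_torus.continuousAt.preimage_mem_nhds (by rwa [torus_one])
  rw [(Units.isEmbedding_val₀ (G₀ := F)).nhds_eq_comap, Filter.mem_comap] at hN1
  obtain ⟨M, hM, hMN⟩ := hN1
  filter_upwards [hM, isOpen_ne.mem_nhds (one_ne_zero (α := F))] with a ha ha0
  have : torusChar η (Units.mk0 a ha0 : F) = 1 := by
    rw [torusChar_unit, h ⟨torus (Units.mk0 a ha0), torus_mem_borel _⟩ (hMN ha), Units.val_one]
  exact this

end Character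

/-! ### Vectors on which the torus acts by a character -/

section Eigenvector

variable {k V : Type*} [Field k] [AddCommGroup V] [Module k V]
  {F : Type*} [Field F] [ValuativeRel F] [TopologicalSpace F] [IsNonarchimedeanLocalField F]

theorem IsSmooth.mem_nhds {G : Type*} [Group G] [TopologicalSpace G] {ρ : Representation k G V}
    (hρ : IsSmooth ρ) (v : V) : {g | ρ g v = v} ∈ 𝓝 (1 : G) := by
  obtain ⟨K, hK, -, h⟩ := hρ v
  exact Filter.mem_of_superset (hK.mem_nhds K.one_mem) h

/-- In a smooth representation of `SL₂`, a vector on which the torus acts by a nontrivial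
character vanishes: contracting by the torus shows that all unipotent matrices fix the vector,
and they generate `SL₂`. -/
theorem eq_zero_of_torus_eigenvector {π : Representation k (Matrix.SpecialLinearGroup (Fin 2) F) V}
    (hπ : IsSmooth π) {χ : F →*₀ k} {a : Fˣ} (ha : χ a ≠ 1) {d : V}
    (hd : ∀ s : Fˣ, π (torus s) d = χ s • d) : d = 0 := by
  have hχ (s : Fˣ) : χ (s : F) ≠ 0 := (map_ne_zero χ).2 s.ne_zero
  have hupper (x : F) : π (upper x) d = d := by
    obtain ⟨s, hs⟩ := exists_unit_sq_mul_mem (N := upper ⁻¹' {g | π g d = d})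
      (continuous_upper.continuousAt.preimage_mem_nhds
        (by rw [upper_zero]; exact hπ.mem_nhds d)) x
    have h := congrArg (π · d) (torus_mul_upper s x)
    simp only [map_mul, Module.End.mul_apply, hd, map_smul] at h
    rw [show π (upper ((s : F) ^ 2 * x)) d = d from hs, ← hd] at h
    have h2 := congrArg (π (torus s)⁻¹) h
    simpa only [← Module.End.mul_apply, ← map_mul, inv_mul_cancel_left,
      inv_mul_cancel, map_one, Module.End.one_apply] using h2
  have hlower (y : F) : π (lower y) d = d := by
    obtain ⟨s, hs⟩ := exists_unit_sq_mul_mem (N := lower ⁻¹' {g | π g d = d})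
      (continuous_lower.continuousAt.preimage_mem_nhds
        (by rw [lower_zero]; exact hπ.mem_nhds d)) y
    have h := congrArg (π · d) (lower_mul_torus s y)
    simp only [map_mul, Module.End.mul_apply, hd, map_smul] at h
    rw [show π (lower ((s : F) ^ 2 * y)) d = d from hs, hd] at h
    exact smul_right_injective V (hχ s) h
  have h := hd a
  rw [torus_eq_prod] at h
  simp only [map_mul, Module.End.mul_apply, hupper, hlower] at h
  by_contra hd0
  exact ha (smul_left_injective k hd0 (a₂ := 1) (by simpa using h.symm))

end Eigenvector

/-! ### The induced representation -/

/-- The set of the `g` in `SL₂(F)` of the form `b * weyl * upper x` with `b` in the Borel subgroup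
and `x` integral. -/
def integralCell (F : Type*) [Field F] [ValuativeRel F] :
    Set (Matrix.SpecialLinearGroup (Fin 2) F) :=
  {g | g 1 0 ≠ 0 ∧ g 1 1 / g 1 0 ∈ 𝒪[F]}

theorem mem_integralCell {F : Type*} [Field F] [ValuativeRel F]
    {g : Matrix.SpecialLinearGroup (Fin 2) F} :
    g ∈ integralCell F ↔ g 1 0 ≠ 0 ∧ g 1 1 / g 1 0 ∈ 𝒪[F] := Iff.rfl

open Classical in
/-- The function on `SL₂(F)` with support `integralCell F` and value `1` at `weyl * upper x` for
integral `x` that transforms under the Borel subgroup by `η`. -/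
noncomputable def bigCellFun {k : Type*} [Field k] {F : Type*} [Field F] [ValuativeRel F]
    (η : borel F →* kˣ) (g : Matrix.SpecialLinearGroup (Fin 2) F) : k :=
  if g ∈ integralCell F then torusChar η (-(g 1 0)⁻¹) else 0

theorem bigCellFun_borel_mul {k : Type*} [Field k] {F : Type*} [Field F] [ValuativeRel F]
    {η : borel F →* kˣ} {b : Matrix.SpecialLinearGroup (Fin 2) F} (hb : b ∈ borel F)
    (g : Matrix.SpecialLinearGroup (Fin 2) F) :
    bigCellFun η (b * g) = torusChar η (b 0 0) * bigCellFun η g := by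
  have h := borel_apply_zero_zero_mul hb
  have h1 : b 1 1 ≠ 0 := right_ne_zero_of_mul_eq_one h
  have h0 : (b 1 1)⁻¹ = b 0 0 := inv_eq_of_mul_eq_one_left h
  have hmem : b * g ∈ integralCell F ↔ g ∈ integralCell F := by
    rw [mem_integralCell, mem_integralCell, apply_mul, apply_mul, mem_borel.1 hb, zero_mul,
      zero_mul, zero_add, zero_add, mul_div_mul_left _ _ h1, mul_ne_zero_iff]
    simp [h1]
  by_cases hg : g ∈ integralCell F
  · rw [bigCellFun, bigCellFun, if_pos hg, if_pos (hmem.2 hg), apply_mul, mem_borel.1 hb, zero_mul,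
      zero_add, mul_inv, h0, ← mul_neg, map_mul]
  · rw [bigCellFun, bigCellFun, if_neg hg, if_neg (mt hmem.1 hg), mul_zero]

section Induced

variable {k : Type*} [Field k] {F : Type*} [Field F] [ValuativeRel F] [TopologicalSpace F]
  [IsNonarchimedeanLocalField F] {η : borel F →* kˣ}

variable (η) in
/-- The space of the smooth induction of `η` from the Borel subgroup to `SL₂(F)`. The value of
`f : IndSpace η` at `g` is `f.1.1 g`. -/
abbrev IndSpace : Type _ :=
  (smoothPart (Representation.coind (borel F).subtype (ofChar η))).toSubmodule

variable (η) in
/-- The action of `SL₂(F)` on `IndSpace η` by right translation. -/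
abbrev indRep : Representation k (Matrix.SpecialLinearGroup (Fin 2) F) (IndSpace η) :=
  smoothInd (borel F) (ofChar η)

theorem indRep_apply (g h : Matrix.SpecialLinearGroup (Fin 2) F) (f : IndSpace η) :
    (indRep η h f).1.1 g = f.1.1 (g * h) := rfl

theorem ind_borel_mul (hη : IsSmooth (ofChar η)) (f : IndSpace η)
    {b : Matrix.SpecialLinearGroup (Fin 2) F} (hb : b ∈ borel F)
    (g : Matrix.SpecialLinearGroup (Fin 2) F) :
    f.1.1 (b * g) = torusChar η (b 0 0) * f.1.1 g := by
  rw [← apply_eq_torusChar hη ⟨b, hb⟩]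
  exact f.1.2 ⟨b, hb⟩ g

theorem ind_stab_mem_nhds (f : IndSpace η) :
    {g | indRep η g f = f} ∈ 𝓝 (1 : Matrix.SpecialLinearGroup (Fin 2) F) := by
  have h : IsOpen (stab (Representation.coind (borel F).subtype (ofChar η)) f.1 :
    Set (Matrix.SpecialLinearGroup (Fin 2) F)) := f.2
  filter_upwards [h.mem_nhds (Subgroup.one_mem _)] with g hg
  exact Subtype.ext hg

/-- A function in the induced representation is determined by its values at `1` and on the
translates `weyl * upper x`. -/
theorem ind_ext (hη : IsSmooth (ofChar η)) {f f' : IndSpace η} (h1 : f.1.1 1 = f'.1.1 1)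
    (hw : ∀ x, f.1.1 (weyl * upper x) = f'.1.1 (weyl * upper x)) : f = f' := by
  refine Subtype.ext (Subtype.ext (funext fun g => ?_))
  by_cases hg : g ∈ borel F
  · rw [← mul_one g, ind_borel_mul hη f hg, ind_borel_mul hη f' hg, h1]
  · obtain ⟨b, hb, x, rfl⟩ := exists_eq_mul_weyl_mul_upper hg
    rw [ind_borel_mul hη f hb, ind_borel_mul hη f' hb, hw]

/-- The function `bigCellFun η` is invariant under right translation by all elements of `SL₂(F)`
close to `1`. -/
theorem bigCellFun_mul_eventually (hη : IsSmooth (ofChar η)) :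
    ∀ᶠ h in 𝓝 (1 : Matrix.SpecialLinearGroup (Fin 2) F), ∀ g,
      bigCellFun η (g * h) = bigCellFun η g := by
  have key : ∀ᶠ h in 𝓝 (1 : Matrix.SpecialLinearGroup (Fin 2) F), ∀ x ∈ (𝒪[F] : Set F),
      torusChar η (h 0 0 + x * h 1 0) = 1 ∧
        (h 0 1 + x * h 1 1) / (h 0 0 + x * h 1 0) ∈ 𝒪[F] := by
    refine isCompact_integers.eventually_forall_of_forall_eventually fun x hx => ?_
    have hc (i j : Fin 2) : Continuous fun z : Matrix.SpecialLinearGroup (Fin 2) F × F =>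
        z.1 i j := by
      have h : Continuous fun g : Matrix.SpecialLinearGroup (Fin 2) F =>
          (g : Matrix (Fin 2) (Fin 2) F) := continuous_subtype_val
      exact (h.matrix_elem i j).comp continuous_fst
    have hc0 : ContinuousAt (fun z : Matrix.SpecialLinearGroup (Fin 2) F × F =>
        z.1 0 0 + z.2 * z.1 1 0) (1, x) :=
      ((hc 0 0).add (continuous_snd.mul (hc 1 0))).continuousAt
    have hc1 : ContinuousAt (fun z : Matrix.SpecialLinearGroup (Fin 2) F × F =>
        (z.1 0 1 + z.2 * z.1 1 1) / (z.1 0 0 + z.2 * z.1 1 0)) (1, x) :=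
      ((hc 0 1).add (continuous_snd.mul (hc 1 1))).continuousAt.div₀ hc0 (by simp)
    refine Filter.Eventually.and (hc0.eventually (p := fun a => torusChar η a = 1) ?_)
      (hc1.eventually (p := fun a => a ∈ 𝒪[F]) ?_)
    · simpa using torusChar_eventually_eq_one hη
    · have h : ∀ᶠ y in 𝓝 x, y ∈ 𝒪[F] := isOpen_integers.mem_nhds hx
      simpa using h
  have key2 : ∀ᶠ h in 𝓝 (1 : Matrix.SpecialLinearGroup (Fin 2) F), ∀ g,
      g ∈ integralCell F → g * h ∈ integralCell F ∧ bigCellFun η (g * h) = bigCellFun η g := by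
    filter_upwards [key] with h hh g hg
    obtain ⟨hg0, hgx⟩ := hg
    obtain ⟨h1, h2⟩ := hh _ hgx
    have e0 : (g * h) 1 0 = g 1 0 * (h 0 0 + g 1 1 / g 1 0 * h 1 0) := by
      rw [apply_mul]
      field_simp
    have e1 : (g * h) 1 1 = g 1 0 * (h 0 1 + g 1 1 / g 1 0 * h 1 1) := by
      rw [apply_mul]
      field_simp
    have hne : h 0 0 + g 1 1 / g 1 0 * h 1 0 ≠ 0 := fun h' => by
      rw [h', map_zero] at h1
      exact zero_ne_one h1
    have hmem : g * h ∈ integralCell F := by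
      refine ⟨by rw [e0]; exact mul_ne_zero hg0 hne, ?_⟩
      rwa [e0, e1, mul_div_mul_left _ _ hg0]
    refine ⟨hmem, ?_⟩
    rw [bigCellFun, bigCellFun, if_pos hmem, if_pos ⟨hg0, hgx⟩, e0, mul_inv, ← neg_mul, map_mul,
      map_inv₀ _ (_ + _), h1, inv_one, mul_one]
  have hinv : ∀ᶠ h in 𝓝 (1 : Matrix.SpecialLinearGroup (Fin 2) F), ∀ g,
      g ∈ integralCell F → g * h⁻¹ ∈ integralCell F ∧
        bigCellFun η (g * h⁻¹) = bigCellFun η g :=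
    (continuous_inv.tendsto' 1 1 inv_one).eventually key2
  filter_upwards [key2, hinv] with h hh hh' g
  by_cases hg : g ∈ integralCell F
  · exact (hh g hg).2
  · have hg' : g * h ∉ integralCell F := fun h' => hg <| by
      have := (hh' _ h').1
      rwa [mul_inv_cancel_right] at this
    rw [bigCellFun, bigCellFun, if_neg hg, if_neg hg']

/-- The function `bigCellFun η` as an element of the smooth induction of `η`. -/
noncomputable def bigCell (hη : IsSmooth (ofChar η)) : IndSpace η :=
  ⟨⟨bigCellFun η, fun b g => by
      rw [ofChar_apply, apply_eq_torusChar hη]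
      exact bigCellFun_borel_mul b.2 g⟩, by
    refine Subgroup.isOpen_of_mem_nhds
      (stab (Representation.coind (borel F).subtype (ofChar η)) _) (g := 1) ?_
    filter_upwards [bigCellFun_mul_eventually hη] with h hh
    exact Subtype.ext (funext hh)⟩

theorem bigCell_apply (hη : IsSmooth (ofChar η)) (g : Matrix.SpecialLinearGroup (Fin 2) F) :
    (bigCell hη).1.1 g = bigCellFun η g := rfl

theorem bigCell_eq_zero (hη : IsSmooth (ofChar η)) {b : Matrix.SpecialLinearGroup (Fin 2) F}
    (hb : b ∈ borel F) : (bigCell hη).1.1 b = 0 := by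
  rw [bigCell_apply, bigCellFun, if_neg fun h => h.1 (mem_borel.1 hb)]

open Classical in
theorem bigCell_weyl_upper_torus (hη : IsSmooth (ofChar η)) (x : F) (s : Fˣ) :
    (bigCell hη).1.1 (weyl * upper x * torus s) =
      if x / (s : F) ^ 2 ∈ 𝒪[F] then (torusChar η s)⁻¹ else 0 := by
  have h0 : (weyl * upper x * torus s : Matrix.SpecialLinearGroup (Fin 2) F) 1 0 = -(s : F) := by
    simp
  have h1 : (weyl * upper x * torus s : Matrix.SpecialLinearGroup (Fin 2) F) 1 1 = -(x / s) := by
    simp [div_eq_mul_inv]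
  have h : weyl * upper x * torus s ∈ integralCell F ↔ x / (s : F) ^ 2 ∈ 𝒪[F] := by
    rw [mem_integralCell, h0, h1, neg_div_neg_eq, div_div, ← pow_two]
    simp
  rw [bigCell_apply, bigCellFun]
  simp only [h]
  rw [h0, inv_neg, neg_neg, map_inv₀]

open Classical in
theorem bigCell_weyl_upper (hη : IsSmooth (ofChar η)) (x : F) :
    (bigCell hη).1.1 (weyl * upper x) = if x ∈ 𝒪[F] then 1 else 0 := by
  have h := bigCell_weyl_upper_torus hη x 1
  rw [torus_one, mul_one] at h
  simpa using h

/-- An element of the induced representation is locally constant in the big cell coordinate,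
uniformly. -/
theorem ind_weyl_upper_add (f : IndSpace η) :
    ∀ᶠ z in 𝓝 (0 : F), ∀ x, f.1.1 (weyl * upper (x + z)) = f.1.1 (weyl * upper x) := by
  have h : ∀ᶠ z in 𝓝 (0 : F), indRep η (upper z) f = f :=
    continuous_upper.continuousAt.preimage_mem_nhds (t := {g | indRep η g f = f})
      (by rw [upper_zero]; exact ind_stab_mem_nhds f)
  filter_upwards [h] with z hz x
  conv_rhs => rw [← hz]
  rw [indRep_apply, mul_assoc, ← upper_add]

/-- If an element of the induced representation vanishes at `1`, then its support in the big cell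
is bounded. -/
theorem exists_bounded_support (hη : IsSmooth (ofChar η)) {f : IndSpace η} (hf : f.1.1 1 = 0) :
    ∃ t : Fˣ, ∀ x, f.1.1 (weyl * upper x) ≠ 0 → (t : F) * x ∈ 𝒪[F] := by
  have h : ∀ᶠ z in 𝓝 (0 : F), indRep η (lower z) f = f :=
    continuous_lower.continuousAt.preimage_mem_nhds (t := {g | indRep η g f = f})
      (by rw [lower_zero]; exact ind_stab_mem_nhds f)
  obtain ⟨t, ht⟩ := exists_unit_mul_integers_subset h
  refine ⟨t, fun x hx => ?_⟩
  rcases eq_or_ne x 0 with rfl | hx0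
  · simp
  refine (mem_integers_or_inv_mem ((t : F) * x)).resolve_right fun h1 => hx ?_
  have hz : indRep η (lower x⁻¹) f = f := by
    have := ht _ h1
    rwa [mul_inv, mul_inv_cancel_left₀ t.ne_zero] at this
  have hb : weyl * upper x * lower (-x⁻¹) ∈ borel F := by simp [mem_borel, hx0]
  have e : weyl * upper x = weyl * upper x * lower (-x⁻¹) * (1 * lower x⁻¹) := by
    rw [one_mul, mul_assoc _ (lower _), ← lower_inv, inv_mul_cancel, mul_one]
  rw [e, ind_borel_mul hη f hb, ← indRep_apply, hz, hf, mul_zero]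

end Induced

/-! ### Decomposition into translates of the big cell function -/

section Decomposition

variable {k : Type*} [Field k] {F : Type*} [Field F] [ValuativeRel F] [TopologicalSpace F]
  [IsNonarchimedeanLocalField F] {η : borel F →* kˣ}

theorem indRep_mul_apply (g h : Matrix.SpecialLinearGroup (Fin 2) F) (f : IndSpace η) :
    indRep η (g * h) f = indRep η g (indRep η h f) := by
  rw [map_mul, Module.End.mul_apply]

open Classical in
theorem translate_weyl_upper (hη : IsSmooth (ofChar η)) (x y : F) (s : Fˣ) :
    (indRep η (upper (-x) * torus s) (bigCell hη)).1.1 (weyl * upper y) =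
      if (y - x) / (s : F) ^ 2 ∈ 𝒪[F] then (torusChar η s)⁻¹ else 0 := by
  rw [indRep_apply, ← bigCell_weyl_upper_torus hη, sub_eq_add_neg, upper_add]
  simp only [mul_assoc]

theorem translate_borel (hη : IsSmooth (ofChar η)) {b : Matrix.SpecialLinearGroup (Fin 2) F}
    (hb : b ∈ borel F) : (indRep η b (bigCell hη)).1.1 1 = 0 := by
  rw [indRep_apply, one_mul, bigCell_eq_zero hη hb]

/-- Evaluation as a linear map on the induced representation. -/
def evalAt (η : borel F →* kˣ) (g : Matrix.SpecialLinearGroup (Fin 2) F) : IndSpace η →ₗ[k] k where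
  toFun f := f.1.1 g
  map_add' _ _ := rfl
  map_smul' _ _ := rfl

/-- For `s` close to `0`, an element of the induced representation that vanishes at `1` is a
finite linear combination of translates of `bigCell` that are supported on balls `x + s² 𝒪` with
`x` in its support. -/
theorem eventually_decomposition (hη : IsSmooth (ofChar η)) {f : IndSpace η} (hf : f.1.1 1 = 0) :
    ∃ N ∈ 𝓝 (0 : F), ∀ s : Fˣ, (s : F) ∈ N → ∃ (R : Finset F) (c : F → k),
      (∀ x ∈ R, f.1.1 (weyl * upper x) ≠ 0) ∧
        f = ∑ x ∈ R, c x • indRep η (upper (-x) * torus s) (bigCell hη) := by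
  classical
  obtain ⟨t, ht⟩ := exists_bounded_support hη hf
  have hsq : Filter.Tendsto (fun s : F => s ^ 2) (𝓝 0) (𝓝 0) :=
    (continuous_pow 2).tendsto' 0 0 (by simp)
  refine ⟨_, hsq.eventually (exists_nhds_mul_integers_subset (ind_weyl_upper_add f)),
    fun s hs => ?_⟩
  have hs0 : (s : F) ^ 2 ≠ 0 := pow_ne_zero 2 s.ne_zero
  -- The ball `s² 𝒪` as an additive subgroup, under which `f` is invariant on the big cell.
  set D : AddSubgroup F := (𝒪[F].toAddSubgroup).comap (AddMonoidHom.mulRight ((s : F) ^ 2)⁻¹)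
  have memD (z : F) : z ∈ D ↔ z / (s : F) ^ 2 ∈ 𝒪[F] := by rw [div_eq_mul_inv]; rfl
  have hDopen : IsOpen (D : Set F) := by
    have : Continuous fun z : F => z * ((s : F) ^ 2)⁻¹ := by fun_prop
    exact isOpen_integers.preimage this
  have hinv {x y : F} (h : y - x ∈ D) :
      f.1.1 (weyl * upper y) = f.1.1 (weyl * upper x) := by
    have h1 := hs _ ((memD _).1 h) x
    rwa [mul_div_cancel₀ _ hs0, add_sub_cancel] at h1
  have := QuotientAddGroup.discreteTopology hDopen
  -- The chosen representative of a coset of `D`.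
  set e : F → F := fun y => Quotient.out (y : F ⧸ D) with he
  have hmk (y : F) : ((e y : F) : F ⧸ D) = y := Quotient.out_eq _
  have he_mem (y : F) : y - e y ∈ D := by
    have := QuotientAddGroup.eq.1 (hmk y)
    rwa [neg_add_eq_sub] at this
  set S : Set F := {x | f.1.1 (weyl * upper x) ≠ 0}
  have hfin : (e '' S).Finite := by
    have hC : IsCompact ((fun x : F => (t : F)⁻¹ * x) '' (𝒪[F] : Set F)) :=
      isCompact_integers.image (by fun_prop)
    have hSC : S ⊆ (fun x : F => (t : F)⁻¹ * x) '' (𝒪[F] : Set F) := fun x hx =>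
      ⟨t * x, ht x hx, inv_mul_cancel_left₀ t.ne_zero x⟩
    have h1 : ((fun x : F => (x : F ⧸ D)) '' S).Finite :=
      ((hC.image continuous_quotient_mk').finite_of_discrete).subset (Set.image_mono hSC)
    have h2 : e '' S = Quotient.out '' ((fun x : F => (x : F ⧸ D)) '' S) := by
      rw [Set.image_image]
    rw [h2]
    exact h1.image _
  have he_eq {x y : F} (hx : x ∈ e '' S) : y - x ∈ D ↔ x = e y := by
    constructor
    · intro h
      obtain ⟨x, -, rfl⟩ := hx
      have : ((x : F) : F ⧸ D) = y := by
        rw [← hmk x, QuotientAddGroup.eq, neg_add_eq_sub]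
        exact h
      simp only [he, this]
    · rintro rfl
      exact he_mem y
  refine ⟨hfin.toFinset, fun x => f.1.1 (weyl * upper x) * torusChar η s, ?_, ?_⟩
  · intro x hx
    obtain ⟨x, hxS, rfl⟩ := hfin.mem_toFinset.1 hx
    rw [← hinv (he_mem x)]
    exact hxS
  · refine ind_ext hη ?_ fun y => ?_
    · change evalAt η 1 f = evalAt η 1 _
      rw [map_sum, Finset.sum_eq_zero]
      · exact hf
      · intro x _
        rw [map_smul]
        have : evalAt η 1 (indRep η (upper (-x) * torus s) (bigCell hη)) = 0 :=
          translate_borel hη (mul_mem (upper_mem_borel _) (torus_mem_borel _))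
        rw [this, smul_zero]
    · change _ = evalAt η (weyl * upper y) _
      rw [map_sum, Finset.sum_congr rfl (g := fun x =>
        if e y = x then f.1.1 (weyl * upper x) else 0), Finset.sum_ite_eq]
      · split_ifs with h
        · exact hinv (he_mem y)
        · by_contra h0
          exact h (hfin.mem_toFinset.2 ⟨y, h0, rfl⟩)
      · intro x hx
        rw [map_smul, smul_eq_mul]
        change _ * (indRep η (upper (-x) * torus s) (bigCell hη)).1.1 (weyl * upper y) = _
        rw [translate_weyl_upper, ← memD]
        simp only [he_eq (hfin.mem_toFinset.1 hx), eq_comm (a := x)]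
        split_ifs
        · rw [mul_assoc, mul_inv_cancel₀ (torusChar_unit_ne_zero η s), mul_one]
        · rw [mul_zero]

end Decomposition

/-! ### Equivariance under the Weyl element -/

section Equivariance

variable {k : Type*} [Field k] {F : Type*} [Field F] [ValuativeRel F] [TopologicalSpace F]
  [IsNonarchimedeanLocalField F] {η : borel F →* kˣ}
  {V : Type*} [AddCommGroup V] [Module k V]
  {π : Representation k (Matrix.SpecialLinearGroup (Fin 2) F) V}

/-- The failure `f ↦ φ (weyl • f) - weyl • φ f` of a linear map `φ` to commute with the Weyl
element. -/
def weylDefect (π : Representation k (Matrix.SpecialLinearGroup (Fin 2) F) V)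
    (φ : IndSpace η →ₗ[k] V) : IndSpace η →ₗ[k] V :=
  φ ∘ₗ indRep η weyl - π weyl ∘ₗ φ

theorem weylDefect_apply (φ : IndSpace η →ₗ[k] V) (f : IndSpace η) :
    weylDefect π φ f = φ (indRep η weyl f) - π weyl (φ f) := rfl

theorem weylDefect_sub_smul (φ : IndSpace η →ₗ[k] V) (f f' : IndSpace η) (c : k) :
    weylDefect π φ (f - c • f') = weylDefect π φ f - c • weylDefect π φ f' :=
  ((weylDefect π φ).map_sub f (c • f')).trans
    (congrArg (weylDefect π φ f - ·) ((weylDefect π φ).map_smul c f'))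

variable {φ : IndSpace η →ₗ[k] V}

/-- The elements `g` with `φ (g • f) = g • φ f` form a union of right cosets of the Borel subgroup
and contain a neighbourhood of `1`. For `x` away from `0`, the element `weyl * upper (-x)` is a
product of an element of the Borel subgroup and a lower unipotent matrix, and for small `s` the
torus element contracts the latter into that neighbourhood. -/
theorem weylDefect_eq_zero_of_vanishing (hη : IsSmooth (ofChar η)) (hπ : IsSmooth π)
    (hφ : ∀ b ∈ borel F, ∀ f, φ (indRep η b f) = π b (φ f)) {f : IndSpace η}
    (hf1 : f.1.1 1 = 0) (hf0 : ∀ᶠ x in 𝓝 (0 : F), f.1.1 (weyl * upper x) = 0) :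
    weylDefect π φ f = 0 := by
  obtain ⟨N, hN, hdec⟩ := eventually_decomposition hη hf1
  obtain ⟨t, ht⟩ := exists_unit_mul_integers_subset hf0
  have hM : {g | indRep η g (bigCell hη) = bigCell hη ∧ π g (φ (bigCell hη)) = φ (bigCell hη)} ∈
      𝓝 (1 : Matrix.SpecialLinearGroup (Fin 2) F) :=
    Filter.inter_mem (ind_stab_mem_nhds _) (hπ.mem_nhds _)
  have hM0 := continuous_lower.continuousAt.preimage_mem_nhds (x := (0 : F))
    (by rw [lower_zero]; exact hM)
  have hsq : Filter.Tendsto (fun s : F => -(s ^ 2 / t)) (𝓝 0) (𝓝 0) := by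
    have : Continuous fun s : F => -(s ^ 2 / t) := by fun_prop
    exact this.tendsto' 0 0 (by simp)
  obtain ⟨s, hsN, hs⟩ := exists_unit_mem
    (Filter.inter_mem hN (hsq.eventually (exists_nhds_mul_integers_subset hM0)))
  obtain ⟨R, c, hR, hfR⟩ := hdec s hsN
  rw [hfR, map_sum]
  refine Finset.sum_eq_zero fun x hx => ?_
  rw [map_smul, weylDefect_apply, hφ _ (mul_mem (upper_mem_borel _) (torus_mem_borel _)),
    ← indRep_mul_apply, ← Module.End.mul_apply, ← map_mul]
  have hx0 : x ≠ 0 := by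
    rintro rfl
    exact hR 0 hx hf0.self_of_nhds
  have hxt : (t : F) / x ∈ 𝒪[F] := by
    have h1 : x / t ∉ 𝒪[F] := fun h => hR x hx <| by
      have := ht _ h
      rwa [mul_div_cancel₀ _ t.ne_zero] at this
    simpa using (mem_integers_or_inv_mem (x / t)).resolve_left h1
  -- The lower unipotent part of `weyl * upper (-x) * torus s`.
  obtain ⟨z, hz⟩ : ∃ z : F, z = -((s : F) ^ 2 / x) := ⟨_, rfl⟩
  have hzM : indRep η (lower z) (bigCell hη) = bigCell hη ∧
      π (lower z) (φ (bigCell hη)) = φ (bigCell hη) := by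
    have h := hs _ hxt
    have e : -((s : F) ^ 2 / t) * (t / x) = z := by
      rw [hz]
      field_simp
    rwa [e] at h
  have hb : weyl * (upper (-x) * torus s) * lower (-z) ∈ borel F := by
    rw [mem_borel, hz]
    simp
    field_simp
    simp
  have e : weyl * (upper (-x) * torus s) =
      weyl * (upper (-x) * torus s) * lower (-z) * lower z := by
    rw [← lower_inv, inv_mul_cancel_right]
  rw [e, indRep_mul_apply, hφ _ hb, map_mul π _ (lower z), Module.End.mul_apply, hzM.1, hzM.2,
    sub_self, smul_zero]

theorem bigCell_apply_weyl (hη : IsSmooth (ofChar η)) : (bigCell hη).1.1 weyl = 1 := by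
  have h := bigCell_weyl_upper hη 0
  rwa [upper_zero, mul_one, if_pos (zero_mem _)] at h

/-- The vector `weylDefect π φ (bigCell hη)` is an eigenvector of the torus with character `η`,
since `bigCell` and a suitable multiple of its translate by the torus agree near the point `weyl`
and at `1`. -/
theorem weylDefect_bigCell_eq_zero (hη : IsSmooth (ofChar η)) (hη1 : η ≠ 1) (hπ : IsSmooth π)
    (hφ : ∀ b ∈ borel F, ∀ f, φ (indRep η b f) = π b (φ f)) :
    weylDefect π φ (bigCell hη) = 0 := by
  classical
  obtain ⟨a, ha⟩ := exists_torusChar_ne_one hη hη1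
  refine eq_zero_of_torus_eigenvector hπ ha fun s => ?_
  have hs := torusChar_unit_ne_zero η s
  have hkey : weylDefect π φ
      (bigCell hη - torusChar η s • indRep η (torus s) (bigCell hη)) = 0 := by
    refine weylDefect_eq_zero_of_vanishing hη hπ hφ ?_ ?_
    · change (bigCell hη).1.1 1 - _ * (indRep η (torus s) (bigCell hη)).1.1 1 = 0
      rw [bigCell_eq_zero hη (one_mem _), translate_borel hη (torus_mem_borel s), mul_zero,
        sub_zero]
    · have h0 : Filter.Tendsto (fun x : F => x / (s : F) ^ 2) (𝓝 0) (𝓝 0) := by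
        have : Continuous fun x : F => x / (s : F) ^ 2 := by fun_prop
        exact this.tendsto' 0 0 (by simp)
      have hO : ∀ᶠ x in 𝓝 (0 : F), x ∈ 𝒪[F] := isOpen_integers.mem_nhds (zero_mem 𝒪[F])
      filter_upwards [hO, h0.eventually hO] with x hx hxs
      change (bigCell hη).1.1 (weyl * upper x) -
        _ * (bigCell hη).1.1 (weyl * upper x * torus s) = 0
      rw [bigCell_weyl_upper, bigCell_weyl_upper_torus, if_pos hx, if_pos hxs,
        mul_inv_cancel₀ hs, sub_self]
  have hcomm : weylDefect π φ (indRep η (torus s) (bigCell hη)) =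
      π (torus s⁻¹) (weylDefect π φ (bigCell hη)) := by
    rw [weylDefect_apply, weylDefect_apply, map_sub, ← indRep_mul_apply, weyl_mul_torus,
      indRep_mul_apply, hφ _ (torus_mem_borel _), hφ _ (torus_mem_borel _),
      ← Module.End.mul_apply, ← Module.End.mul_apply, ← map_mul, ← map_mul, weyl_mul_torus]
  rw [weylDefect_sub_smul, hcomm, sub_eq_zero] at hkey
  conv_lhs => rw [hkey]
  rw [map_smul, ← Module.End.mul_apply, ← map_mul, ← torus_mul, mul_inv_cancel, torus_one, map_one,
    Module.End.one_apply]

theorem weylDefect_eq_zero_of_apply_one (hη : IsSmooth (ofChar η)) (hη1 : η ≠ 1)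
    (hπ : IsSmooth π) (hφ : ∀ b ∈ borel F, ∀ f, φ (indRep η b f) = π b (φ f)) {f : IndSpace η}
    (hf : f.1.1 1 = 0) : weylDefect π φ f = 0 := by
  classical
  have h : weylDefect π φ (f - f.1.1 weyl • bigCell hη) = 0 := by
    refine weylDefect_eq_zero_of_vanishing hη hπ hφ ?_ ?_
    · change f.1.1 1 - _ * (bigCell hη).1.1 1 = 0
      rw [hf, bigCell_eq_zero hη (one_mem _), mul_zero, sub_zero]
    · have hO : ∀ᶠ x in 𝓝 (0 : F), x ∈ 𝒪[F] := isOpen_integers.mem_nhds (zero_mem 𝒪[F])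
      filter_upwards [hO, ind_weyl_upper_add f] with x hx hxf
      change f.1.1 (weyl * upper x) - _ * (bigCell hη).1.1 (weyl * upper x) = 0
      have := hxf 0
      rw [zero_add, upper_zero, mul_one] at this
      rw [this, bigCell_weyl_upper, if_pos hx, mul_one, sub_self]
  rwa [weylDefect_sub_smul, weylDefect_bigCell_eq_zero hη hη1 hπ hφ, smul_zero, sub_zero] at h

theorem weylDefect_eq_zero (hη : IsSmooth (ofChar η)) (hη1 : η ≠ 1) (hπ : IsSmooth π)
    (hφ : ∀ b ∈ borel F, ∀ f, φ (indRep η b f) = π b (φ f)) (f : IndSpace η) :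
    weylDefect π φ f = 0 := by
  have h := weylDefect_eq_zero_of_apply_one hη hη1 hπ hφ
    (f := f - f.1.1 1 • indRep η weyl (bigCell hη)) (by
      change f.1.1 1 - _ * (bigCell hη).1.1 (1 * weyl) = 0
      rw [one_mul, bigCell_apply_weyl, mul_one, sub_self])
  have h2 : weylDefect π φ (indRep η weyl (bigCell hη)) = 0 := by
    have h3 := weylDefect_bigCell_eq_zero hη hη1 hπ hφ
    rw [weylDefect_apply, sub_eq_zero] at h3
    rw [weylDefect_apply, h3, ← indRep_mul_apply, ← Module.End.mul_apply, ← map_mul,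
      weyl_mul_weyl, hφ _ (torus_mem_borel _), sub_self]
  rwa [weylDefect_sub_smul, h2, smul_zero, sub_zero] at h

/-- A Borel-equivariant map out of the induction of a nontrivial smooth character is
`SL₂(F)`-equivariant. -/
theorem equivariant_of_borel_equivariant (hη : IsSmooth (ofChar η)) (hη1 : η ≠ 1)
    (hπ : IsSmooth π) (hφ : ∀ b ∈ borel F, ∀ f, φ (indRep η b f) = π b (φ f))
    (g : Matrix.SpecialLinearGroup (Fin 2) F) (f : IndSpace η) :
    φ (indRep η g f) = π g (φ f) := by
  by_cases hg : g ∈ borel F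
  · exact hφ g hg f
  · have hw (f : IndSpace η) : φ (indRep η weyl f) = π weyl (φ f) :=
      sub_eq_zero.1 (weylDefect_eq_zero hη hη1 hπ hφ f)
    obtain ⟨b, hb, x, rfl⟩ := exists_eq_mul_weyl_mul_upper hg
    rw [indRep_mul_apply, indRep_mul_apply, hφ b hb, hw, hφ _ (upper_mem_borel x), map_mul,
      map_mul, Module.End.mul_apply, Module.End.mul_apply]

end Equivariance

end SmoothRep

theorem corollary5p11 (p : ℕ) [Fact p.Prime]
    {k : Type*} [Field k] [Algebra (ZMod p) k] [IsAlgClosure (ZMod p) k]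
    {F : Type*} [Field F] [ValuativeRel F] [TopologicalSpace F] [IsNonarchimedeanLocalField F]
    [CharP 𝓀[F] p]
    (η : SmoothRep.borel F →* kˣ) (hη : SmoothRep.IsSmooth (SmoothRep.ofChar η)) (hη1 : η ≠ 1)
    {V : Type*} [AddCommGroup V] [Module k V]
    (π : Representation k (Matrix.SpecialLinearGroup (Fin 2) F) V)
    (hπ : SmoothRep.IsSmooth π) :
    Function.Bijective
      (SmoothRep.resHom (SmoothRep.borel F)
        (SmoothRep.smoothInd (SmoothRep.borel F) (SmoothRep.ofChar η)) π) := by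
  constructor
  · intro φ ψ h
    exact Representation.IntertwiningMap.ext (congrArg (·.toLinearMap) h)
  · intro φ
    have hφ : ∀ b ∈ SmoothRep.borel F, ∀ f,
        φ.toLinearMap (SmoothRep.indRep η b f) = π b (φ.toLinearMap f) := fun b hb f =>
      LinearMap.congr_fun (φ.isIntertwining' ⟨b, hb⟩) f
    exact ⟨⟨φ.toLinearMap, fun g => LinearMap.ext fun f =>
      SmoothRep.equivariant_of_borel_equivariant hη hη1 hπ hφ g f⟩, rfl⟩
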